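/- Let $f:\mathbb{R}^d\to\mathbb{R}$ be differentiable and convex, with a minimizer $x^*\in\mathbb{R}^d$, and let $\gamma(t)=\frac{6}{t+1}$ for $t\ge 0$. Let $(X_t,Y_t)_{t\ge 0}$ be a randomized Hamiltonian flow (RHF) of $f$ with refreshment rate $\gamma$, that is, a process in $\mathbb{R}^d\times\mathbb{R}^d$, adapted to a filtration $(\mathcal{F}_t)_{t\ge0}$ on a probability space, that almost surely solves for all $t\ge0$ $$X_t = X_0+\int_0^t Y_s\,\mathrm{d}s,\qquad Y_t = Y_0-\int_0^t\nabla f(X_s)\,\mathrm{d}s-\sum_{k\ge1,\;T_k\le t} Y_{T_k^-},$$ where the integrands are integrable on bounded time intervals and $T_1<T_2<\cdots$ are the event times of an inhomogeneous Poisson process with rate $\gamma(t)$ relative to $(\mathcal{F}_t)$ (its counting process $N$ is adapted, and for $0\le s\le t$ the increment $N_t-N_s$ is independent of $\mathcal{F}_s$ and Poisson distributed with mean $\int_s^t\gamma(u)\,\mathrm{d}u$). In words: $(X_t,Y_t)$ follows the Hamiltonian flow $\dot X_t=Y_t$, $\dot Y_t=-\nabla f(X_t)$ between the events, and the velocity is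 reset to $Y_{T_k}=0$ at each event. Assume $Y_0=0$ almost surely; the initial position $X_0$ is arbitrary, deterministic or random. Then for every $t\ge0$, $$\mathbb{E}\left[f(X_t)-f(x^*)\right]\le\frac{5\,\mathbb{E}\left[f(X_0)-f(x^*)+\|X_0-x^*\|^2\right]}{(t+1)^2},$$ where both expectations are of nonnegative random variables and take values in $[0,\infty]$; in particular, if the expectation on the right-hand side is finite, then so is the one on the left. -/

import Mathlib

open MeasureTheory ProbabilityTheory

namespace RHF

/-- The counting process `N_t = #{k ≥ 1 : T_k ≤ t}` of the event times `T_1 < T_2 < ⋯`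
(for locally finite event times, the only case in which it is used, the set is finite). -/
noncomputable def eventCount {Ω : Type*} (T : ℕ → Ω → ℝ) (t : ℝ) (ω : Ω) : ℕ :=
  {k : ℕ | 1 ≤ k ∧ T k ω ≤ t}.ncard

/-- `T_1 < T_2 < ⋯` (with the convention `T_0 = 0`) are the event times of an inhomogeneous
Poisson process on `(0, ∞)` with rate function `γ`, relative to the filtration `ℱ`: the event
times are locally finite, the counting process `N` is adapted, and for `0 ≤ s ≤ t` the increment
`N_t - N_s` is independent of `ℱ_s` and Poisson distributed with mean `∫ u in s..t, γ u`.
Times are real numbers, and only times `t ≥ 0` matter. -/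
structure IsPoissonProcess {Ω : Type*} {mΩ : MeasurableSpace Ω} (P : Measure Ω)
    (ℱ : Filtration ℝ mΩ) (γ : ℝ → ℝ) (T : ℕ → Ω → ℝ) : Prop where
  time_zero : ∀ᵐ ω ∂P, T 0 ω = 0
  strictMono : ∀ᵐ ω ∂P, StrictMono fun k => T k ω
  tendsto_atTop : ∀ᵐ ω ∂P, Filter.Tendsto (fun k => T k ω) Filter.atTop Filter.atTop
  adapted : ∀ t : ℝ, 0 ≤ t → Measurable[ℱ t] (eventCount T t)
  increment_law : ∀ s t : ℝ, 0 ≤ s → s ≤ t →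
    HasLaw (fun ω => eventCount T t ω - eventCount T s ω)
      (poissonMeasure (∫ u in s..t, γ u).toNNReal) P
  increment_indep : ∀ s t : ℝ, 0 ≤ s → s ≤ t →
    Indep (ℱ s)
      (MeasurableSpace.comap (fun ω => eventCount T t ω - eventCount T s ω) inferInstance) P

/-- `(X, Y)` is a randomized Hamiltonian flow of `f` with refreshment rate `γ` and refreshment
times `T_1 < T_2 < ⋯`: the `T_k` are the event times of a Poisson process with rate `γ`, the
process `(X, Y)` is adapted, and almost surely, for all `t ≥ 0`, it solves the integrated form of
`dX_t = Y_t dt`, `dY_t = -∇f(X_t) dt - Y_{t-} dN_t`, `dN = ∑_{k ≥ 1} δ_{T_k}`, that is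
`X_t = X_0 + ∫_0^t Y_s ds` and `Y_t = Y_0 - ∫_0^t ∇f(X_s) ds - ∑_{k ≥ 1, T_k ≤ t} Y_{T_k-}`.
The indices `k ≥ 1` with `T_k ≤ t` are exactly `1, …, N_t`, as the `T_k` are increasing. -/
structure IsRandomizedHamiltonianFlow {Ω : Type*} {mΩ : MeasurableSpace Ω} (P : Measure Ω)
    (ℱ : Filtration ℝ mΩ) {d : ℕ} (f : EuclideanSpace ℝ (Fin d) → ℝ) (γ : ℝ → ℝ)
    (T : ℕ → Ω → ℝ) (X Y : ℝ → Ω → EuclideanSpace ℝ (Fin d)) : Prop where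
  poisson : IsPoissonProcess P ℱ γ T
  adapted_position : ∀ t : ℝ, 0 ≤ t → Measurable[ℱ t] (X t)
  adapted_velocity : ∀ t : ℝ, 0 ≤ t → Measurable[ℱ t] (Y t)
  integrable_velocity : ∀ᵐ ω ∂P, ∀ t : ℝ, 0 ≤ t →
    IntervalIntegrable (fun s => Y s ω) volume 0 t
  integrable_gradient : ∀ᵐ ω ∂P, ∀ t : ℝ, 0 ≤ t →
    IntervalIntegrable (fun s => gradient f (X s ω)) volume 0 t
  position_eq : ∀ᵐ ω ∂P, ∀ t : ℝ, 0 ≤ t →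
    X t ω = X 0 ω + ∫ s in (0 : ℝ)..t, Y s ω
  velocity_eq : ∀ᵐ ω ∂P, ∀ t : ℝ, 0 ≤ t →
    Y t ω = Y 0 ω - (∫ s in (0 : ℝ)..t, gradient f (X s ω))
      - ∑ k ∈ Finset.Icc 1 (eventCount T t ω), Function.leftLim (fun s => Y s ω) (T k ω)

end RHF

namespace RHF

open Set Filter Topology
open scoped RealInnerProductSpace

/-! ### Convexity: the tangent inequality and continuity of the gradient. -/

section ConvexGradient

variable {E : Type*} [NormedAddCommGroup E] [InnerProductSpace ℝ E] [CompleteSpace E]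
  {f : E → ℝ}

/-! The proof is a Lyapunov argument. Write `L` for `lyapunov` and `G` for `refreshGap`. Along the
Hamiltonian flow, convexity gives `dL/dt ≤ (6 / (t + 1)) * G`. A refreshment lowers `L` by exactly
`G`, and refreshments occur at rate `6 / (t + 1)`, so the two effects cancel in mean and `E[L]` is
nonincreasing. Completing a square gives `(t + 1)² (f(X_t) - f(x*)) ≤ L`. At time `0`, where the
velocity vanishes, `L` is at most five times the initial quantity.

No stochastic calculus is needed. Over a short interval of length `h` with Poisson mean `r`, the
path is treated separately for zero, one and at least two events
(`exists_lyapunov_increment_bound`). To leading order the increment of `L` is `r * G` with no event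
and `-G` with one, where `G` is taken at the left endpoint. This weight has mean zero under the
Poisson law and is independent of the past, so its contribution vanishes
(`IsPoissonProcess.integral_mul_twoPoint_eq_zero`). The remainder has mean `O(h²)`, and summing over
finer partitions gives monotonicity (`le_of_forall_le_add_sq`).

Uniform constants require bounded paths. On an event where the initial data are bounded, energy
decay and continuity of the gradient provide them. Monotone convergence then removes the
restriction. -/

/-- The chain rule for a differentiable function along a curve. -/
theorem hasDerivWithinAt_comp_gradient (hf : Differentiable ℝ f) {x : ℝ → E} {v : E} {s : Set ℝ}
    {u : ℝ} (hx : HasDerivWithinAt x v s u) :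
    HasDerivWithinAt (fun r => f (x r)) ⟪gradient f (x u), v⟫ s u := by
  exact (hf (x u)).hasGradientAt.hasFDerivAt.comp_hasDerivWithinAt u hx

theorem add_inner_gradient_le (hf : Differentiable ℝ f) (hconv : ConvexOn ℝ univ f) (x y : E) :
    f x + ⟪gradient f x, y - x⟫ ≤ f y := by
  have hline : ∀ u : ℝ, HasDerivAt (fun r : ℝ => x + r • (y - x)) (y - x) u := fun u => by
    simpa using ((hasDerivAt_id u).smul_const (y - x)).const_add x
  have hd : HasDerivAt (fun r : ℝ => f (x + r • (y - x))) ⟪gradient f x, y - x⟫ 0 := by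
    have := hasDerivWithinAt_comp_gradient hf (hline 0).hasDerivWithinAt (s := univ)
    simpa using this
  have hc : ConvexOn ℝ univ (fun r : ℝ => f (x + r • (y - x))) := by
    have := hconv.comp_affineMap (AffineMap.lineMap x y : ℝ →ᵃ[ℝ] E)
    simpa [Function.comp_def, AffineMap.lineMap_apply, add_comm] using this
  have := hc.le_slope_of_hasDerivAt (mem_univ 0) (mem_univ 1) one_pos hd
  simp only [slope_def_field, one_smul, add_sub_cancel, zero_smul, add_zero, sub_zero,
    div_one] at this
  linarith

/-- Subtracting the linear form of `g` leaves a function minimized at `x`, whose derivative there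
vanishes. This identifies cluster points of the gradient. -/
theorem gradient_eq_of_forall_add_inner_le (hf : Differentiable ℝ f) {x g : E}
    (h : ∀ y, f x + ⟪g, y - x⟫ ≤ f y) : gradient f x = g := by
  have hd : HasFDerivAt (fun y => f y - ⟪g, y⟫)
      (InnerProductSpace.toDual ℝ E (gradient f x) - innerSL ℝ g) x :=
    (hf x).hasGradientAt.hasFDerivAt.sub (innerSL ℝ g).hasFDerivAt
  have hm : IsLocalMin (fun y => f y - ⟪g, y⟫) x := Eventually.of_forall fun y => by
    have := h y
    rw [inner_sub_right] at this
    show f x - ⟪g, x⟫ ≤ f y - ⟪g, y⟫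
    linarith
  have h0 := hm.hasFDerivAt_eq_zero hd
  refine ext_inner_right ℝ fun v => ?_
  exact sub_eq_zero.1 (DFunLike.congr_fun h0 v)

/-- A differentiable convex function on a finite-dimensional space is `C¹`. -/
theorem continuous_gradient [FiniteDimensional ℝ E] (hf : Differentiable ℝ f)
    (hconv : ConvexOn ℝ univ f) : Continuous (gradient f) := by
  refine continuous_iff_continuousAt.2 fun x => ?_
  obtain ⟨K, s, hs, hK⟩ := hconv.locallyLipschitz x
  have hbd : ∀ᶠ y in 𝓝 x, gradient f y ∈ Metric.closedBall (0 : E) K := by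
    filter_upwards [eventually_mem_nhds_iff.2 hs] with y hy
    have h1 := norm_fderiv_le_of_lipschitzOn ℝ hy hK
    rw [mem_closedBall_zero_iff, gradient, LinearIsometryEquiv.norm_map]
    exact h1
  -- Gradients near `x` stay in a compact ball, so it suffices that every cluster point `g` be a
  -- subgradient at `x`. The tangent inequality is a closed condition on (point, gradient), hence
  -- passes to the limit.
  refine (isCompact_closedBall (0 : E) (K : ℝ)).tendsto_nhds_of_unique_mapClusterPt hbd ?_
  intro g _ hg
  refine (gradient_eq_of_forall_add_inner_le hf fun y => ?_).symm
  have hpair : MapClusterPt (x, g) (𝓝 x) (fun z => (z, gradient f z)) := by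
    rw [((nhds_basis_opens x).prod_nhds (nhds_basis_opens g)).mapClusterPt_iff_frequently]
    rintro ⟨U, V⟩ ⟨⟨hxU, hU⟩, hgV, hV⟩
    exact ((mapClusterPt_iff_frequently.1 hg V (hV.mem_nhds hgV)).and_eventually
      (hU.mem_nhds hxU)).mono fun z hz => ⟨hz.2, hz.1⟩
  have hcl : IsClosed {p : E × E | f p.1 + ⟪p.2, y - p.1⟫ ≤ f y} := by
    refine isClosed_le ?_ continuous_const
    have := hf.continuous
    fun_prop
  have : (x, g) ∈ {p : E × E | f p.1 + ⟪p.2, y - p.1⟫ ≤ f y} :=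
    isClosed_iff_clusterPt.1 hcl _ (hpair.clusterPt.mono (le_principal_iff.2
      (mem_map.2 (Eventually.of_forall fun z => add_inner_gradient_le hf hconv z y))))
  exact this

end ConvexGradient

/-! ### Algebra of the Lyapunov function. -/

section Lyapunov

variable {E : Type*} [NormedAddCommGroup E] [InnerProductSpace ℝ E] {f : E → ℝ}

/-- The Lyapunov function for the refreshment rate `6 / (t + 1)`. -/
noncomputable def lyapunov (f : E → ℝ) (p : E) (t : ℝ) (x y : E) : ℝ :=
  (t + 1) ^ 2 * (f x - f p + ‖y‖ ^ 2 / 2) + 2 * (t + 1) * ⟪x - p, y⟫ + 5 * ‖x - p‖ ^ 2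

/-- The amount by which a refreshment of the velocity decreases the Lyapunov function. -/
noncomputable def refreshGap (p : E) (t : ℝ) (x y : E) : ℝ :=
  (t + 1) ^ 2 * (‖y‖ ^ 2 / 2) + 2 * (t + 1) * ⟪x - p, y⟫

theorem lyapunov_zero_velocity (p : E) (t : ℝ) (x y : E) :
    lyapunov f p t x 0 = lyapunov f p t x y - refreshGap p t x y := by
  simp [lyapunov, refreshGap]
  ring

theorem refreshGap_zero_velocity (p : E) (t : ℝ) (x : E) : refreshGap p t x 0 = 0 := by
  simp [refreshGap]

/-- The velocity terms equal `‖(t + 1) y + 2 (x - p)‖² / 2 - 2 ‖x - p‖²`, and the term `5 ‖x - p‖²`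
absorbs the negative part. -/
theorem sq_mul_le_lyapunov {p : E} {t : ℝ} (x y : E) :
    (t + 1) ^ 2 * (f x - f p) ≤ lyapunov f p t x y := by
  have h : 0 ≤ ‖(t + 1) • y + (2 : ℝ) • (x - p)‖ ^ 2 := by positivity
  rw [norm_add_sq_real, norm_smul, norm_smul, inner_smul_left, inner_smul_right, mul_pow, mul_pow,
    Real.norm_eq_abs, Real.norm_eq_abs, sq_abs, sq_abs, real_inner_comm] at h
  simp only [conj_trivial] at h
  unfold lyapunov
  nlinarith [sq_nonneg ‖x - p‖]

theorem abs_refreshGap_le {p x y : E} {t K B : ℝ} (ht : 0 ≤ t) (htK : t ≤ K)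
    (hy : ‖y‖ ≤ B) (hx : ‖x - p‖ ≤ B) : |refreshGap p t x y| ≤ 8 * (K + 1) ^ 2 * B ^ 2 := by
  have hB : 0 ≤ B := (norm_nonneg _).trans hy
  have h1 : |⟪x - p, y⟫| ≤ B ^ 2 := (abs_real_inner_le_norm _ _).trans (by
    rw [sq]; exact mul_le_mul hx hy (norm_nonneg _) hB)
  have h2 : ‖y‖ ^ 2 ≤ B ^ 2 := by gcongr
  have h3 : (t + 1) ^ 2 ≤ (K + 1) ^ 2 := by gcongr
  have h4 : t + 1 ≤ (K + 1) ^ 2 := by nlinarith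
  unfold refreshGap
  calc _ ≤ |(t + 1) ^ 2 * (‖y‖ ^ 2 / 2)| + |2 * (t + 1) * ⟪x - p, y⟫| := abs_add_le _ _
    _ = (t + 1) ^ 2 * (‖y‖ ^ 2 / 2) + 2 * (t + 1) * |⟪x - p, y⟫| := by
      rw [abs_of_nonneg (by positivity), abs_mul, abs_of_nonneg (by positivity)]
    _ ≤ (K + 1) ^ 2 * (B ^ 2 / 2) + 2 * (K + 1) ^ 2 * B ^ 2 := by gcongr
    _ ≤ _ := by nlinarith [mul_nonneg (sq_nonneg (K + 1)) (sq_nonneg B)]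

end Lyapunov

/-! ### Evolution between two refreshments. -/

section Segment

variable {E : Type*} [NormedAddCommGroup E] [InnerProductSpace ℝ E] [CompleteSpace E]
  {f : E → ℝ}

/-- `(x, y)` solves Hamilton's equations `x' = y`, `y' = -∇f(x)` on `[a, b]`. -/
structure IsHamiltonianOn (f : E → ℝ) (a b : ℝ) (x y : ℝ → E) : Prop where
  position : ∀ u ∈ Icc a b, HasDerivWithinAt x (y u) (Icc a b) u
  velocity : ∀ u ∈ Icc a b, HasDerivWithinAt y (-gradient f (x u)) (Icc a b) u

theorem IsHamiltonianOn.mono {a b a' b' : ℝ} {x y : ℝ → E} (h : IsHamiltonianOn f a b x y)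
    (ha : a ≤ a') (hb : b' ≤ b) : IsHamiltonianOn f a' b' x y :=
  ⟨fun u hu => (h.position u (Icc_subset_Icc ha hb hu)).mono (Icc_subset_Icc ha hb),
    fun u hu => (h.velocity u (Icc_subset_Icc ha hb hu)).mono (Icc_subset_Icc ha hb)⟩

/-- The energy is conserved along the Hamiltonian flow. -/
theorem IsHamiltonianOn.energy_eq {a b : ℝ} {x y : ℝ → E} (hf : Differentiable ℝ f)
    (h : IsHamiltonianOn f a b x y) {u : ℝ} (hu : u ∈ Icc a b) :
    f (x u) + ‖y u‖ ^ 2 / 2 = f (x a) + ‖y a‖ ^ 2 / 2 := by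
  have hd : ∀ r ∈ Icc a b, HasDerivWithinAt (fun r => f (x r) + ‖y r‖ ^ 2 / 2) 0 (Icc a b) r := by
    intro r hr
    have h2 := (hasDerivWithinAt_comp_gradient hf (h.position r hr)).add
      ((h.velocity r hr).norm_sq.div_const 2)
    refine h2.congr_deriv ?_
    rw [inner_neg_right, real_inner_comm]
    ring
  have := norm_image_sub_le_of_norm_deriv_le_segment' hd (C := 0) (by simp) u hu
  simpa [sub_eq_zero] using this

theorem IsHamiltonianOn.hasDerivWithinAt_inner {a b u : ℝ} {x y : ℝ → E}
    (h : IsHamiltonianOn f a b x y) (p : E) (hu : u ∈ Icc a b) :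
    HasDerivWithinAt (fun r => ⟪x r - p, y r⟫)
      (‖y u‖ ^ 2 - ⟪x u - p, gradient f (x u)⟫) (Icc a b) u := by
  refine (((h.position u hu).sub_const p).inner ℝ (h.velocity u hu)).congr_deriv ?_
  rw [inner_neg_right, real_inner_self_eq_norm_sq]
  ring

theorem IsHamiltonianOn.hasDerivWithinAt_refreshGap {a b u : ℝ} {x y : ℝ → E}
    (h : IsHamiltonianOn f a b x y) (p : E) (hu : u ∈ Icc a b) :
    HasDerivWithinAt (fun r => refreshGap p r (x r) (y r))
      (3 * (u + 1) * ‖y u‖ ^ 2 - (u + 1) ^ 2 * ⟪y u, gradient f (x u)⟫ + 2 * ⟪x u - p, y u⟫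
        - 2 * (u + 1) * ⟪x u - p, gradient f (x u)⟫) (Icc a b) u := by
  have hτ : HasDerivWithinAt (fun r : ℝ => r + 1) 1 (Icc a b) u :=
    (hasDerivWithinAt_id u _).add_const 1
  have := ((hτ.pow 2).mul ((h.velocity u hu).norm_sq.div_const 2)).add
    ((hτ.const_mul 2).mul (h.hasDerivWithinAt_inner p hu))
  refine this.congr_deriv ?_
  simp only [inner_neg_right, Pi.pow_apply]
  push_cast
  ring

/-- The terms in `⟪y, ∇f⟫` cancel by energy conservation. The coefficient `12 = 2 + 10` comes from
the cross term and from `5 ‖x - p‖²`; with the `3` it matches the rate `6 / (t + 1)` times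
`refreshGap`. -/
theorem IsHamiltonianOn.hasDerivWithinAt_lyapunov {a b u : ℝ} {x y : ℝ → E}
    (hf : Differentiable ℝ f) (h : IsHamiltonianOn f a b x y) (p : E) (hu : u ∈ Icc a b) :
    HasDerivWithinAt (fun r => lyapunov f p r (x r) (y r))
      (2 * (u + 1) * (f (x u) - f p - ⟪x u - p, gradient f (x u)⟫) + 3 * (u + 1) * ‖y u‖ ^ 2
        + 12 * ⟪x u - p, y u⟫) (Icc a b) u := by
  have hτ : HasDerivWithinAt (fun r : ℝ => r + 1) 1 (Icc a b) u :=
    (hasDerivWithinAt_id u _).add_const 1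
  have hE := ((hasDerivWithinAt_comp_gradient hf (h.position u hu)).sub_const (f p)).add
      ((h.velocity u hu).norm_sq.div_const 2)
  have := (((hτ.pow 2).mul hE).add ((hτ.const_mul 2).mul (h.hasDerivWithinAt_inner p hu))).add
    ((((h.position u hu).sub_const p).norm_sq).const_mul 5)
  refine this.congr_deriv ?_
  simp only [inner_neg_right, Pi.pow_apply, Pi.add_apply, real_inner_comm (gradient f (x u)) (y u)]
  push_cast
  ring

/-- Bounding the derivative allows the gap to be frozen at the left endpoint, where it depends only
on the past. -/
theorem IsHamiltonianOn.abs_refreshGap_sub_le {a b K B : ℝ} {x y : ℝ → E}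
    (h : IsHamiltonianOn f a b x y) (p : E) (ha : 0 ≤ a) (hbK : b ≤ K)
    (hy : ∀ u ∈ Icc a b, ‖y u‖ ≤ B) (hx : ∀ u ∈ Icc a b, ‖x u - p‖ ≤ B)
    (hg : ∀ u ∈ Icc a b, ‖gradient f (x u)‖ ≤ B) {u : ℝ} (hu : u ∈ Icc a b) :
    |refreshGap p u (x u) (y u) - refreshGap p a (x a) (y a)|
      ≤ 8 * (K + 1) ^ 2 * B ^ 2 * (u - a) := by
  refine norm_image_sub_le_of_norm_deriv_le_segment'
    (fun r hr => h.hasDerivWithinAt_refreshGap p hr) (fun r hr => ?_) u hu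
  have hr' := Ico_subset_Icc_self hr
  have hB : 0 ≤ B := (norm_nonneg _).trans (hy r hr')
  have hr0 : 0 ≤ r := ha.trans hr'.1
  have hrK : r ≤ K := hr'.2.trans hbK
  have hin : ∀ v w : E, ‖v‖ ≤ B → ‖w‖ ≤ B → |⟪v, w⟫| ≤ B ^ 2 := fun v w hv hw =>
    (abs_real_inner_le_norm _ _).trans (by rw [sq]; exact mul_le_mul hv hw (norm_nonneg _) hB)
  have h1 := abs_le.1 (hin _ _ (hy r hr') (hg r hr'))
  have h2 := abs_le.1 (hin _ _ (hx r hr') (hy r hr'))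
  have h3 := abs_le.1 (hin _ _ (hx r hr') (hg r hr'))
  have h4 : ‖y r‖ ^ 2 ≤ B ^ 2 := by gcongr; exact hy r hr'
  have h5 : 0 ≤ ‖y r‖ ^ 2 := by positivity
  have key : (3 * (r + 1) + (r + 1) ^ 2 + 2 + 2 * (r + 1)) * B ^ 2 ≤ 8 * (K + 1) ^ 2 * B ^ 2 := by
    have : 0 ≤ (K - r) * (K + r + 2) := by apply mul_nonneg <;> linarith
    gcongr
    nlinarith
  have h6 : 0 ≤ r + 1 := by linarith
  have h7 : 0 ≤ (r + 1) ^ 2 := by positivity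
  rw [Real.norm_eq_abs, abs_le]
  constructor
  · nlinarith [mul_le_mul_of_nonneg_left h4 h6, mul_nonneg h6 h5,
      mul_le_mul_of_nonneg_left h1.2 h7, mul_le_mul_of_nonneg_left h3.2 h6]
  · nlinarith [mul_le_mul_of_nonneg_left h4 h6,
      mul_le_mul_of_nonneg_left h1.1 h7, mul_le_mul_of_nonneg_left h3.1 h6]

theorem IsHamiltonianOn.lyapunov_sub_le {a b K B : ℝ} {x y : ℝ → E} (hf : Differentiable ℝ f)
    (hconv : ConvexOn ℝ univ f)
    (h : IsHamiltonianOn f a b x y) (p : E) (ha : 0 ≤ a) (hab : a ≤ b) (hbK : b ≤ K)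
    (hy : ∀ u ∈ Icc a b, ‖y u‖ ≤ B) (hx : ∀ u ∈ Icc a b, ‖x u - p‖ ≤ B)
    (hg : ∀ u ∈ Icc a b, ‖gradient f (x u)‖ ≤ B) :
    lyapunov f p b (x b) (y b) - lyapunov f p a (x a) (y a)
      ≤ (refreshGap p a (x a) (y a) + 8 * (K + 1) ^ 2 * B ^ 2 * (b - a))
        * (6 * (Real.log (b + 1) - Real.log (a + 1))) := by
  -- `c` dominates the gap on all of `[a, b]`; subtracting `c` times the integrated rate makes the
  -- Lyapunov function nonincreasing.
  set c := refreshGap p a (x a) (y a) + 8 * (K + 1) ^ 2 * B ^ 2 * (b - a) with hc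
  have hlog : ∀ r ∈ Icc a b, HasDerivWithinAt (fun r : ℝ => c * (6 * Real.log (r + 1)))
      (c * (6 * (1 / (r + 1)))) (Icc a b) r := fun r hr => by
    have : r + 1 ≠ 0 := by linarith [hr.1]
    exact ((((hasDerivWithinAt_id r _).add_const 1).log this).const_mul 6).const_mul c
  have hd : ∀ r ∈ Icc a b, HasDerivWithinAt
      (fun r => lyapunov f p r (x r) (y r) - c * (6 * Real.log (r + 1))) _ (Icc a b) r :=
    fun r hr => (h.hasDerivWithinAt_lyapunov hf p hr).sub (hlog r hr)
  have hanti := antitoneOn_of_hasDerivWithinAt_nonpos (convex_Icc a b)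
    (fun r hr => (hd r hr).continuousWithinAt)
    (fun r hr => (hd r (interior_subset hr)).mono interior_subset) (fun r hr => by
      have hr' := interior_subset hr
      have hr1 : 0 < r + 1 := by linarith [hr'.1]
      have h1 := (abs_le.1 (h.abs_refreshGap_sub_le p ha hbK hy hx hg hr')).2
      have h2 : refreshGap p r (x r) (y r) ≤ c := by
        have : 8 * (K + 1) ^ 2 * B ^ 2 * (r - a) ≤ 8 * (K + 1) ^ 2 * B ^ 2 * (b - a) := by
          gcongr; exact hr'.2
        linarith
      have h3 : 3 * (r + 1) * ‖y r‖ ^ 2 + 12 * ⟪x r - p, y r⟫ =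
          refreshGap p r (x r) (y r) * (6 * (1 / (r + 1))) := by
        unfold refreshGap; field_simp; ring
      have h4 : refreshGap p r (x r) (y r) * (6 * (1 / (r + 1))) ≤ c * (6 * (1 / (r + 1))) := by
        gcongr
      have h5 := add_inner_gradient_le hf hconv (x r) p
      rw [← neg_sub (x r) p, inner_neg_right, real_inner_comm] at h5
      nlinarith [mul_nonneg hr1.le (by linarith :
        0 ≤ -(f (x r) - f p - ⟪x r - p, gradient f (x r)⟫))])
  have := hanti (left_mem_Icc.2 hab) (right_mem_Icc.2 hab) hab
  simp only at this
  linarith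

end Segment

end RHF

namespace RHF

open Set Filter Topology
open scoped RealInnerProductSpace

/-! ### Deterministic analysis of a single path with refreshments. -/

theorem eventCount_eq {Ω : Type*} {T : ℕ → Ω → ℝ} {ω : Ω} (hT : StrictMono fun k => T k ω)
    {n : ℕ} {u : ℝ} (hn : T n ω ≤ u) (hn' : u < T (n + 1) ω) : eventCount T u ω = n := by
  have : {k : ℕ | 1 ≤ k ∧ T k ω ≤ u} = (Finset.Icc 1 n : Finset ℕ) := by
    ext k
    simp only [mem_ofPred_eq, Finset.coe_Icc, mem_Icc]
    refine and_congr_right fun _ => ⟨fun h => ?_, fun h => (hT.monotone h).trans hn⟩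
    exact Nat.lt_succ_iff.1 (hT.lt_iff_lt.1 (h.trans_lt hn'))
  rw [eventCount, this, ncard_coe_finset]
  simp

theorem exists_mem_Ico_of_tendsto {T : ℕ → ℝ} (h0 : T 0 = 0) (hT : Tendsto T atTop atTop)
    {u : ℝ} (hu : 0 ≤ u) : ∃ n, T n ≤ u ∧ u < T (n + 1) := by
  classical
  have hex : ∃ n, u < T n := (hT.eventually_gt_atTop u).exists
  obtain ⟨m, hm⟩ : ∃ m, Nat.find hex = m + 1 := Nat.exists_eq_succ_of_ne_zero fun h => by
    have := Nat.find_spec hex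
    rw [h, h0] at this
    linarith
  exact ⟨m, not_lt.1 (Nat.find_min hex (by omega)), hm ▸ Nat.find_spec hex⟩

section Path

variable {E : Type*} [NormedAddCommGroup E] [InnerProductSpace ℝ E] [CompleteSpace E]
  {f : E → ℝ}

/-- A path `(x, v)` which follows the Hamiltonian flow between the times `T 0 = 0 < T 1 < ⋯`, at
which its velocity vanishes; `y n` is the continuous version of `v` on `[T n, T (n + 1)]`. -/
structure IsRefreshedPath (f : E → ℝ) (T : ℕ → ℝ) (x v : ℝ → E) (y : ℕ → ℝ → E) : Prop where
  time_zero : T 0 = 0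
  strictMono : StrictMono T
  segment : ∀ n, IsHamiltonianOn f (T n) (T (n + 1)) x (y n)
  start : ∀ n, y n (T n) = 0
  velocity : ∀ n, ∀ u ∈ Ico (T n) (T (n + 1)), v u = y n u

/-- The integrated equation of a randomized Hamiltonian flow determines a refreshed path. -/
theorem exists_isRefreshedPath {Ω : Type*} {T : ℕ → Ω → ℝ} {X Y : ℝ → Ω → E} {ω : Ω}
    (hcont : Continuous (gradient f)) (h0 : T 0 ω = 0) (hmono : StrictMono fun k => T k ω)
    (hint : ∀ t : ℝ, 0 ≤ t → IntervalIntegrable (fun s => Y s ω) volume 0 t)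
    (hX : ∀ t : ℝ, 0 ≤ t → X t ω = X 0 ω + ∫ s in (0 : ℝ)..t, Y s ω)
    (hY : ∀ t : ℝ, 0 ≤ t → Y t ω = Y 0 ω - (∫ s in (0 : ℝ)..t, gradient f (X s ω))
      - ∑ k ∈ Finset.Icc 1 (eventCount T t ω), Function.leftLim (fun s => Y s ω) (T k ω))
    (hY0 : Y 0 ω = 0) :
    ∃ y, IsRefreshedPath f (fun k => T k ω) (fun t => X t ω) (fun t => Y t ω) y := by
  have hTnn : ∀ n, 0 ≤ T n ω := fun n => h0 ▸ hmono.monotone (Nat.zero_le n)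
  have hXc : ContinuousOn (fun t => X t ω) (Ici 0) := by
    intro t ht
    have ht : (0 : ℝ) ≤ t := ht
    have h1 := intervalIntegral.continuousOn_primitive_interval'
      (hint (t + 1) (by linarith)) left_mem_uIcc
    rw [uIcc_of_le (by linarith)] at h1
    have h2 : ContinuousWithinAt (fun t => X t ω) (Icc 0 (t + 1)) t :=
      ((continuousOn_const (c := X 0 ω)).add h1 t ⟨ht, by linarith⟩).congr
        (fun r hr => hX r hr.1) (hX t ht)
    refine h2.mono_of_mem_nhdsWithin ?_
    rw [← Ici_inter_Iic]
    exact inter_mem_nhdsWithin _ (Iic_mem_nhds (by linarith))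
  -- Clamping time at `0` gives a globally continuous integrand, so its primitive is differentiable
  -- everywhere.
  set g : ℝ → E := fun t => gradient f (X (max t 0) ω) with hg
  have hgc : Continuous g := hcont.comp
    (hXc.comp_continuous (continuous_id.max continuous_const) fun t => le_max_right t 0)
  have hgX : ∀ t, 0 ≤ t → g t = gradient f (X t ω) := fun t ht => by simp [hg, max_eq_left ht]
  have hG : ∀ t, HasDerivAt (fun t => ∫ s in (0 : ℝ)..t, g s) (g t) t := fun t =>
    hgc.integral_hasStrictDerivAt 0 t |>.hasDerivAt
  have hGX : ∀ t, 0 ≤ t → ∫ s in (0 : ℝ)..t, gradient f (X s ω) = ∫ s in (0 : ℝ)..t, g s :=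
    fun t ht => intervalIntegral.integral_congr fun s hs => by
      rw [uIcc_of_le ht] at hs
      exact (hgX s hs.1).symm
  -- Freezing the number of jumps at `n` extends the velocity smoothly past the next event; its
  -- value there is the left limit of `Y`, which the jump cancels.
  set y : ℕ → ℝ → E := fun n t => (Y 0 ω - ∫ s in (0 : ℝ)..t, g s)
      - ∑ k ∈ Finset.Icc 1 n, Function.leftLim (fun s => Y s ω) (T k ω) with hy
  have hyd : ∀ n t, HasDerivAt (y n) (-g t) t := fun n t =>
    ((hG t).const_sub _).sub_const _
  have hyc : ∀ n, Continuous (y n) := fun n =>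
    continuous_iff_continuousAt.2 fun t => (hyd n t).continuousAt
  have hYy : ∀ n, ∀ u ∈ Ico (T n ω) (T (n + 1) ω), Y u ω = y n u := fun n u hu => by
    have hu0 := (hTnn n).trans hu.1
    rw [hY u hu0, eventCount_eq hmono hu.1 hu.2, hGX u hu0]
  have hlim : ∀ n, Function.leftLim (fun s => Y s ω) (T (n + 1) ω) = y n (T (n + 1) ω) := fun n => by
    refine leftLim_eq_of_tendsto ?_
    refine ((hyc n).continuousAt.tendsto.mono_left nhdsWithin_le_nhds).congr' ?_
    filter_upwards [Ico_mem_nhdsLT (hmono n.lt_succ_self)] with u hu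
    exact (hYy n u hu).symm
  refine ⟨y, h0, hmono, fun n => ⟨fun u hu => ?_, fun u hu => ?_⟩, fun n => ?_, hYy⟩
  · have hI : ∀ r ∈ Icc (T n ω) (T (n + 1) ω),
        X r ω = X (T n ω) ω + ∫ s in (T n ω)..r, y n s := fun r hr => by
      have hr0 := (hTnn n).trans hr.1
      have hadd := intervalIntegral.integral_add_adjacent_intervals (hint _ (hTnn n))
        ((hint _ (hTnn n)).symm.trans (hint r hr0))
      have hcong : ∫ s in (T n ω)..r, Y s ω = ∫ s in (T n ω)..r, y n s := by
        refine intervalIntegral.integral_congr_ae ?_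
        filter_upwards [compl_mem_ae_iff.2 (measure_singleton r)] with s hs hs'
        rw [uIoc_of_le hr.1] at hs'
        exact hYy n s ⟨hs'.1.le, (lt_of_le_of_ne hs'.2 hs).trans_le hr.2⟩
      rw [hX r hr0, hX _ (hTnn n), ← hadd, hcong, add_assoc]
    have hd : HasDerivAt (fun r => X (T n ω) ω + ∫ s in (T n ω)..r, y n s) (y n u) u :=
      ((hyc n).integral_hasStrictDerivAt _ u).hasDerivAt.const_add _
    exact hd.hasDerivWithinAt.congr hI (hI u hu)
  · show HasDerivWithinAt (y n) (-gradient f (X u ω)) _ u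
    rw [← hgX u ((hTnn n).trans hu.1)]
    exact (hyd n u).hasDerivWithinAt
  · cases n with
    | zero => simp [hy, h0, hY0]
    | succ n =>
      have : y (n + 1) (T (n + 1) ω) = y n (T (n + 1) ω)
          - Function.leftLim (fun s => Y s ω) (T (n + 1) ω) := by
        simp only [hy]
        rw [Finset.sum_Icc_succ_top (by omega), sub_add_eq_sub_sub]
      rw [this, hlim, sub_self]

variable {T : ℕ → ℝ} {x v : ℝ → E} {y : ℕ → ℝ → E}

theorem IsRefreshedPath.time_nonneg (h : IsRefreshedPath f T x v y) (n : ℕ) : 0 ≤ T n :=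
  h.time_zero ▸ h.strictMono.monotone (Nat.zero_le n)

/-- The energy of a refreshed path never exceeds its initial potential energy. -/
theorem IsRefreshedPath.energy_le (hf : Differentiable ℝ f) (h : IsRefreshedPath f T x v y)
    (n : ℕ) : ∀ u ∈ Icc (T n) (T (n + 1)), f (x u) + ‖y n u‖ ^ 2 / 2 ≤ f (x 0) := by
  have hle : ∀ n, T n ≤ T (n + 1) := fun n => h.strictMono.monotone n.le_succ
  have hstart : ∀ n, f (x (T n)) ≤ f (x 0) := fun n => by
    induction n with
    | zero => rw [h.time_zero]
    | succ n ih =>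
      have := (h.segment n).energy_eq hf (right_mem_Icc.2 (hle n))
      rw [h.start n, norm_zero] at this
      nlinarith [sq_nonneg ‖y n (T (n + 1))‖]
  intro u hu
  rw [(h.segment n).energy_eq hf hu, h.start n, norm_zero]
  linarith [hstart n]

theorem IsRefreshedPath.norm_velocity_le (hf : Differentiable ℝ f)
    (h : IsRefreshedPath f T x v y) {p : E} (hp : ∀ z, f p ≤ f z) {V : ℝ} (hV : 0 ≤ V)
    (hfV : f (x 0) - f p ≤ V ^ 2 / 2) (n : ℕ) : ∀ u ∈ Icc (T n) (T (n + 1)), ‖y n u‖ ≤ V := by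
  intro u hu
  have := h.energy_le hf n u hu
  exact abs_le_of_sq_le_sq' (by linarith [hp (x u)]) hV |>.2

theorem IsRefreshedPath.norm_position_sub_le (h : IsRefreshedPath f T x v y) {V : ℝ}
    (hV : ∀ n, ∀ u ∈ Icc (T n) (T (n + 1)), ‖y n u‖ ≤ V) (n : ℕ) :
    ∀ u ∈ Icc (T n) (T (n + 1)), ‖x u - x 0‖ ≤ V * u := by
  have hle : ∀ n, T n ≤ T (n + 1) := fun n => h.strictMono.monotone n.le_succ
  have hseg : ∀ n, ∀ u ∈ Icc (T n) (T (n + 1)), ‖x u - x (T n)‖ ≤ V * (u - T n) := fun n u hu =>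
    norm_image_sub_le_of_norm_deriv_le_segment' (h.segment n).position
      (fun r hr => hV n r (Ico_subset_Icc_self hr)) u hu
  have hstart : ∀ n, ‖x (T n) - x 0‖ ≤ V * T n := fun n => by
    induction n with
    | zero => simp [h.time_zero]
    | succ n ih =>
      have := norm_sub_le_norm_sub_add_norm_sub (x (T (n + 1))) (x (T n)) (x 0)
      linarith [hseg n _ (right_mem_Icc.2 (hle n))]
  intro u hu
  have := norm_sub_le_norm_sub_add_norm_sub (x u) (x (T n)) (x 0)
  linarith [hseg n u hu, hstart n]

/-- A refreshed path is bounded on `[0, K]`, uniformly over bounded sets of initial data. -/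
theorem exists_bound_isRefreshedPath [FiniteDimensional ℝ E] (hf : Differentiable ℝ f)
    (hconv : ConvexOn ℝ univ f) {p : E} (hp : ∀ z, f p ≤ f z) (K M : ℝ) :
    ∃ B : ℝ, 0 ≤ B ∧ ∀ (T : ℕ → ℝ) (x v : ℝ → E) (y : ℕ → ℝ → E), IsRefreshedPath f T x v y →
      f (x 0) - f p + ‖x 0 - p‖ ^ 2 ≤ M → ∀ n, ∀ u ∈ Icc (T n) (T (n + 1)), u ≤ K →
        ‖y n u‖ ≤ B ∧ ‖x u - p‖ ≤ B ∧ ‖gradient f (x u)‖ ≤ B := by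
  -- `V` bounds both the speed, by energy, and the initial distance to `p`; hence the distance stays
  -- below `V + V * |K|` up to time `K`.
  set V := Real.sqrt (2 * |M|) with hVdef
  have hV : 0 ≤ V := Real.sqrt_nonneg _
  have hV2 : V ^ 2 = 2 * |M| := Real.sq_sqrt (by positivity)
  set R := V + V * |K| with hR
  have hR0 : 0 ≤ R := by positivity
  obtain ⟨G, hG⟩ := (isCompact_closedBall p R).exists_bound_of_continuousOn
    (continuous_gradient hf hconv).continuousOn
  refine ⟨max V (max R G), hV.trans (le_max_left _ _), fun T x v y h hM n u hu huK => ?_⟩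
  have h1 : f (x 0) - f p ≤ V ^ 2 / 2 := by
    linarith [le_abs_self M, sq_nonneg ‖x 0 - p‖]
  have h2 : ‖x 0 - p‖ ≤ V := by
    refine (abs_le_of_sq_le_sq' ?_ hV).2
    linarith [le_abs_self M, hp (x 0), abs_nonneg M]
  have hy := h.norm_velocity_le hf hp hV h1
  have hx : ‖x u - p‖ ≤ R := by
    have := norm_sub_le_norm_sub_add_norm_sub (x u) (x 0) p
    have h3 := h.norm_position_sub_le hy n u hu
    have : V * u ≤ V * |K| := by gcongr; exact huK.trans (le_abs_self K)
    linarith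
  exact ⟨(hy n u hu).trans (le_max_left _ _), hx.trans ((le_max_left _ _).trans (le_max_right _ _)),
    (hG (x u) (mem_closedBall_iff_norm.2 hx)).trans ((le_max_right _ _).trans (le_max_right _ _))⟩

theorem log_add_one_sub_log_le {s t : ℝ} (hs : 0 ≤ s) (hst : s ≤ t) :
    0 ≤ Real.log (t + 1) - Real.log (s + 1) ∧ Real.log (t + 1) - Real.log (s + 1) ≤ t - s := by
  have h1 : 0 < s + 1 := by linarith
  have h2 : 0 < t + 1 := by linarith
  refine ⟨sub_nonneg.2 (Real.log_le_log h1 (by linarith)), ?_⟩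
  rw [← Real.log_div h2.ne' h1.ne']
  refine (Real.log_le_sub_one_of_pos (by positivity)).trans ?_
  rw [div_sub_one h1.ne', div_le_iff₀ h1]
  nlinarith

/-- Increments of the Lyapunov function along a refreshed path, over a time interval with no
event and over a time interval with one event. -/
theorem exists_lyapunov_increment_bound [FiniteDimensional ℝ E] (hf : Differentiable ℝ f)
    (hconv : ConvexOn ℝ univ f) {p : E} (hp : ∀ z, f p ≤ f z) {K : ℝ} (hK : 0 ≤ K) (M : ℝ) :
    ∃ C : ℝ, 0 ≤ C ∧ ∀ (T : ℕ → ℝ) (x v : ℝ → E) (y : ℕ → ℝ → E), IsRefreshedPath f T x v y →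
      f (x 0) - f p + ‖x 0 - p‖ ^ 2 ≤ M → ∀ n s, T n ≤ s → s < T (n + 1) → s ≤ K →
        |lyapunov f p s (x s) (v s)| ≤ C ∧ |refreshGap p s (x s) (v s)| ≤ C ∧
        ∀ t, s ≤ t → t ≤ K →
          (t < T (n + 1) → lyapunov f p t (x t) (v t) - lyapunov f p s (x s) (v s) ≤
            refreshGap p s (x s) (v s) * (6 * (Real.log (t + 1) - Real.log (s + 1)))
              + C * (t - s) ^ 2) ∧
          (T (n + 1) ≤ t → t < T (n + 2) →
            lyapunov f p t (x t) (v t) - lyapunov f p s (x s) (v s) ≤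
              -refreshGap p s (x s) (v s) + C * (t - s)) := by
  obtain ⟨B, hB0, hB⟩ := exists_bound_isRefreshedPath hf hconv hp K M
  set Λ := 8 * (K + 1) ^ 2 * B ^ 2 with hΛ
  have hΛ0 : 0 ≤ Λ := by positivity
  set C₁ := (K + 1) ^ 2 * |M| + Λ + 5 * B ^ 2 with hC₁
  have hC₁0 : 0 ≤ C₁ := by positivity
  have hC₁Λ : Λ ≤ C₁ := by
    have : 0 ≤ (K + 1) ^ 2 * |M| := by positivity
    nlinarith [sq_nonneg B]
  -- `C₁` bounds the Lyapunov function and `Λ` the gap and its slope. With one event at `r`, the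
  -- errors are at most `Λ (7 + 6 K) (r - s)` before it and `6 Λ K (t - r)` after it.
  refine ⟨C₁ + Λ * (7 + 12 * K), by positivity, fun T x v y h hM n s hns hsn hsK => ?_⟩
  have hCK : Λ * 7 ≤ Λ * (7 + 12 * K) := by gcongr; linarith
  have hs0 : 0 ≤ s := (h.time_nonneg n).trans hns
  have hsI : s ∈ Icc (T n) (T (n + 1)) := ⟨hns, hsn.le⟩
  have hvs := h.velocity n s ⟨hns, hsn⟩
  obtain ⟨b1, b2, b3⟩ := hB T x v y h hM n s hsI hsK
  have hgap : |refreshGap p s (x s) (y n s)| ≤ Λ := abs_refreshGap_le hs0 hsK b1 b2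
  rw [hvs]
  refine ⟨?_, hgap.trans (by linarith), fun t hst htK => ⟨fun htn => ?_, fun htn htn2 => ?_⟩⟩
  · have h1 : 0 ≤ f (x s) - f p := sub_nonneg.2 (hp _)
    have h2 : f (x s) - f p ≤ |M| := by
      have := h.energy_le hf n s hsI
      linarith [le_abs_self M, sq_nonneg ‖x 0 - p‖, sq_nonneg ‖y n s‖]
    have h3 : (s + 1) ^ 2 * (f (x s) - f p) ≤ (K + 1) ^ 2 * |M| := by gcongr
    have h4 : ‖x s - p‖ ^ 2 ≤ B ^ 2 := by gcongr
    have h5 := abs_le.1 hgap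
    have h6 : lyapunov f p s (x s) (y n s) = (s + 1) ^ 2 * (f (x s) - f p)
        + refreshGap p s (x s) (y n s) + 5 * ‖x s - p‖ ^ 2 := by
      unfold lyapunov refreshGap; ring
    have h7 : 0 ≤ (s + 1) ^ 2 * (f (x s) - f p) := by positivity
    have h8 : 0 ≤ Λ * 7 := by positivity
    rw [h6, abs_le]
    constructor <;> nlinarith [sq_nonneg ‖x s - p‖]
  · have hsub : ∀ u ∈ Icc s t, u ∈ Icc (T n) (T (n + 1)) ∧ u ≤ K := fun u hu =>
      ⟨⟨hns.trans hu.1, hu.2.trans htn.le⟩, hu.2.trans htK⟩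
    have hb := fun u hu => hB T x v y h hM n u (hsub u hu).1 (hsub u hu).2
    have := ((h.segment n).mono hns htn.le).lyapunov_sub_le hf hconv p hs0 hst htK
      (fun u hu => (hb u hu).1) (fun u hu => (hb u hu).2.1) (fun u hu => (hb u hu).2.2)
    rw [h.velocity n t ⟨hns.trans hst, htn⟩]
    obtain ⟨l1, l2⟩ := log_add_one_sub_log_le hs0 hst
    have h1 : Λ * (t - s) * (6 * (Real.log (t + 1) - Real.log (s + 1))) ≤
        Λ * (t - s) * (6 * (t - s)) := by
      have := sub_nonneg.2 hst
      gcongr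
    nlinarith [mul_le_mul_of_nonneg_right hCK (sq_nonneg (t - s)),
      mul_nonneg hC₁0 (sq_nonneg (t - s)), mul_nonneg hΛ0 (sq_nonneg (t - s))]
  · set r := T (n + 1) with hr
    have hr0 : 0 ≤ r := h.time_nonneg _
    have hrI : r ∈ Icc (T n) (T (n + 1)) := right_mem_Icc.2 (h.strictMono.monotone n.le_succ)
    have hsub : ∀ u ∈ Icc s r, u ∈ Icc (T n) (T (n + 1)) ∧ u ≤ K := fun u hu =>
      ⟨⟨hns.trans hu.1, hu.2⟩, hu.2.trans (htn.trans htK)⟩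
    have hb := fun u hu => hB T x v y h hM n u (hsub u hu).1 (hsub u hu).2
    have seg₁ := ((h.segment n).mono hns hr.le)
    have i₁ := seg₁.lyapunov_sub_le hf hconv p hs0 hsn.le (htn.trans htK)
      (fun u hu => (hb u hu).1) (fun u hu => (hb u hu).2.1) (fun u hu => (hb u hu).2.2)
    have g₁ := abs_le.1 (seg₁.abs_refreshGap_sub_le p hs0 (htn.trans htK)
      (fun u hu => (hb u hu).1) (fun u hu => (hb u hu).2.1) (fun u hu => (hb u hu).2.2)
      (right_mem_Icc.2 hsn.le))
    have hsub' : ∀ u ∈ Icc r t, u ∈ Icc (T (n + 1)) (T (n + 2)) ∧ u ≤ K := fun u hu =>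
      ⟨⟨hu.1, hu.2.trans htn2.le⟩, hu.2.trans htK⟩
    have hb' := fun u hu => hB T x v y h hM (n + 1) u (hsub' u hu).1 (hsub' u hu).2
    have i₂ := ((h.segment (n + 1)).mono le_rfl htn2.le).lyapunov_sub_le hf hconv p hr0 htn htK
      (fun u hu => (hb' u hu).1) (fun u hu => (hb' u hu).2.1) (fun u hu => (hb' u hu).2.2)
    -- After the event the velocity, hence the gap, is zero. The jump contributes minus the gap just
    -- before `r`, which is close to the gap at `s`.
    rw [h.start (n + 1), refreshGap_zero_velocity, zero_add,
      lyapunov_zero_velocity p r (x r) (y n r)] at i₂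
    rw [h.velocity (n + 1) t ⟨htn, htn2⟩]
    obtain ⟨l1, l2⟩ := log_add_one_sub_log_le hs0 hsn.le
    obtain ⟨l3, l4⟩ := log_add_one_sub_log_le hr0 htn
    have d1 : 0 ≤ r - s := sub_nonneg.2 hsn.le
    have d2 : 0 ≤ t - r := sub_nonneg.2 htn
    have e₁ : (refreshGap p s (x s) (y n s) + Λ * (r - s)) *
        (6 * (Real.log (r + 1) - Real.log (s + 1))) ≤ (Λ + Λ * K) * (6 * (r - s)) := by
      gcongr
      · exact (le_abs_self _).trans hgap
      · linarith
    have e₂ : Λ * (t - r) * (6 * (Real.log (t + 1) - Real.log (r + 1))) ≤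
        Λ * K * (6 * (t - r)) := by
      gcongr
      linarith
    have e₃ : (C₁ + Λ * (7 + 12 * K)) * (t - s) = C₁ * (t - s) + Λ * (7 + 12 * K) * (r - s)
        + Λ * (7 + 12 * K) * (t - r) := by ring
    have e₄ : 0 ≤ C₁ * (t - s) := mul_nonneg hC₁0 (by linarith)
    have e₅ := mul_nonneg hΛ0 d2
    have e₆ := mul_nonneg (mul_nonneg hΛ0 hK) d2
    have e₇ := mul_nonneg (mul_nonneg hΛ0 hK) d1
    have e₈ := g₁.1
    rw [← hΛ] at i₁ i₂ e₈
    linarith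

end Path

end RHF

namespace RHF

open Set Filter Topology
open scoped RealInnerProductSpace

/-! ### Time discretization and Poisson computations. -/

/-- A function whose increments are bounded above quadratically is nonincreasing. -/
theorem le_of_forall_le_add_sq {a : ℝ → ℝ} {C K : ℝ} (hK : 0 ≤ K)
    (h : ∀ s t, 0 ≤ s → s ≤ t → t ≤ K → a t ≤ a s + C * (t - s) ^ 2) : a K ≤ a 0 := by
  -- Over `n + 1` equal steps the errors add up to `(n + 1) * C * (K / (n + 1)) ^ 2`, which tends to
  -- zero.
  have hn : ∀ n : ℕ, a K ≤ a 0 + C * K ^ 2 * (1 / ((n : ℝ) + 1)) := fun n => by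
    have hn0 : (0 : ℝ) < (n : ℝ) + 1 := by positivity
    have hstep : ∀ k : ℕ, k ≤ n + 1 →
        a (k * (K / (n + 1))) ≤ a 0 + k * (C * (K / (n + 1)) ^ 2) := fun k => by
      induction k with
      | zero => simp
      | succ k ih =>
        intro hk
        have hk' : ((k + 1 : ℕ) : ℝ) ≤ (n : ℝ) + 1 := by exact_mod_cast hk
        have hd : 0 ≤ K / ((n : ℝ) + 1) := by positivity
        have h1 := h (k * (K / (n + 1))) ((k + 1 : ℕ) * (K / (n + 1))) (by positivity)
          (by gcongr; simp) (by
            calc ((k + 1 : ℕ) : ℝ) * (K / (n + 1)) ≤ (n + 1) * (K / (n + 1)) := by gcongr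
              _ = K := by field_simp)
        have h2 := ih (by omega)
        push_cast at h1 ⊢
        have h3 : ((k : ℝ) + 1) * (K / (n + 1)) - k * (K / (n + 1)) = K / (n + 1) := by ring
        rw [h3] at h1
        linarith
    have := hstep (n + 1) le_rfl
    push_cast at this
    rw [mul_div_cancel₀ K hn0.ne'] at this
    refine this.trans (le_of_eq ?_)
    field_simp
  have hlim : Tendsto (fun n : ℕ => a 0 + C * K ^ 2 * (1 / ((n : ℝ) + 1))) atTop (𝓝 (a 0)) := by
    simpa using (tendsto_one_div_add_atTop_nhds_zero_nat (𝕜 := ℝ)).const_mul (C * K ^ 2)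
      |>.const_add (a 0)
  exact ge_of_tendsto' hlim hn

theorem integral_six_div {s t : ℝ} (hs : 0 ≤ s) (hst : s ≤ t) :
    ∫ u in s..t, 6 / (u + 1) = 6 * (Real.log (t + 1) - Real.log (s + 1)) := by
  have hpos : ∀ u ∈ uIcc s t, u + 1 ≠ 0 := fun u hu => by
    rw [uIcc_of_le hst] at hu
    linarith [hu.1]
  rw [intervalIntegral.integral_eq_sub_of_hasDerivAt (f := fun u => 6 * Real.log (u + 1))]
  · ring
  · intro u hu
    have := (((hasDerivAt_id u).add_const 1).log (hpos u hu)).const_mul 6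
    refine this.congr_deriv ?_
    simp [div_eq_mul_inv]
  · refine ContinuousOn.intervalIntegrable ?_
    exact continuousOn_const.div (by fun_prop) hpos

/-- The function on `ℕ` equal to `c + a` at `0`, to `c + b` at `1` and to `c` elsewhere. -/
noncomputable def twoPoint (c a b : ℝ) (k : ℕ) : ℝ :=
  c + ({0} : Set ℕ).indicator (fun _ => a) k + ({1} : Set ℕ).indicator (fun _ => b) k

theorem integrable_twoPoint {μ : Measure ℕ} [IsFiniteMeasure μ] (c a b : ℝ) :
    Integrable (twoPoint c a b) μ :=
  ((integrable_const c).add ((integrable_const a).indicator (measurableSet_singleton 0))).add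
    ((integrable_const b).indicator (measurableSet_singleton 1))

theorem integral_twoPoint_poissonMeasure (r : NNReal) (c a b : ℝ) :
    ∫ k, twoPoint c a b k ∂(poissonMeasure r) = c + a * Real.exp (-r) + b * (r * Real.exp (-r)) := by
  have h0 : Integrable (({0} : Set ℕ).indicator (fun _ => a)) (poissonMeasure r) :=
    (integrable_const a).indicator (measurableSet_singleton 0)
  have h1 : Integrable (({1} : Set ℕ).indicator (fun _ => b)) (poissonMeasure r) :=
    (integrable_const b).indicator (measurableSet_singleton 1)
  have h : twoPoint c a b = ((fun _ => c) + ({0} : Set ℕ).indicator fun _ => a)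
    + ({1} : Set ℕ).indicator fun _ => b := rfl
  rw [h, integral_add' ((integrable_const c).add h0) h1, integral_add' (integrable_const c) h0,
    integral_indicator_const _ (measurableSet_singleton 0),
    integral_indicator_const _ (measurableSet_singleton 1),
    poissonMeasure_real_singleton, poissonMeasure_real_singleton]
  simp
  ring

/-! ### The Lyapunov function decreases in mean along the random flow. -/

section Flow

variable {d : ℕ} {f : EuclideanSpace ℝ (Fin d) → ℝ} {xstar : EuclideanSpace ℝ (Fin d)}
  {Ω : Type*} {mΩ : MeasurableSpace Ω} {P : Measure Ω} {ℱ : Filtration ℝ mΩ}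
  {T : ℕ → Ω → ℝ} {X Y : ℝ → Ω → EuclideanSpace ℝ (Fin d)} {γ : ℝ → ℝ}

theorem IsRandomizedHamiltonianFlow.ae_exists_isRefreshedPath
    (h : IsRandomizedHamiltonianFlow P ℱ f γ T X Y)
    (hcont : Continuous (gradient f)) (hY : ∀ᵐ ω ∂P, Y 0 ω = 0) :
    ∀ᵐ ω ∂P, ∃ y, IsRefreshedPath f (fun k => T k ω) (fun t => X t ω) (fun t => Y t ω) y := by
  filter_upwards [h.poisson.time_zero, h.poisson.strictMono, h.integrable_velocity,
    h.position_eq, h.velocity_eq, hY] with ω h1 h2 h3 h4 h5 h6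
  exact exists_isRefreshedPath hcont h1 h2 h3 h4 h5 h6

/-- The event that the initial position is bounded, in terms of the potential at `0`. -/
def initialEvent (f : EuclideanSpace ℝ (Fin d) → ℝ) (xstar : EuclideanSpace ℝ (Fin d))
    (X : ℝ → Ω → EuclideanSpace ℝ (Fin d)) (M : ℝ) : Set Ω :=
  {ω | f (X 0 ω) - f xstar + ‖X 0 ω - xstar‖ ^ 2 ≤ M}

theorem IsRandomizedHamiltonianFlow.measurableSet_initialEvent
    (h : IsRandomizedHamiltonianFlow P ℱ f γ T X Y) (hf : Continuous f) (M : ℝ) {t : ℝ}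
    (ht : 0 ≤ t) : MeasurableSet[ℱ t] (initialEvent f xstar X M) := by
  refine ℱ.mono ht _ ?_
  have hc : Continuous fun z => f z - f xstar + ‖z - xstar‖ ^ 2 := by fun_prop
  exact (hc.measurable.comp (h.adapted_position 0 le_rfl)) measurableSet_Iic

theorem IsRandomizedHamiltonianFlow.measurable_comp
    (h : IsRandomizedHamiltonianFlow P ℱ f γ T X Y)
    {g : EuclideanSpace ℝ (Fin d) → EuclideanSpace ℝ (Fin d) → ℝ}
    (hg : Continuous fun z : EuclideanSpace ℝ (Fin d) × EuclideanSpace ℝ (Fin d) => g z.1 z.2)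
    {t : ℝ} (ht : 0 ≤ t) : Measurable[ℱ t] (fun ω => g (X t ω) (Y t ω)) :=
  hg.measurable.comp ((h.adapted_position t ht).prodMk (h.adapted_velocity t ht))

theorem continuous_lyapunov (hf : Continuous f) (t : ℝ) :
    Continuous fun z : EuclideanSpace ℝ (Fin d) × EuclideanSpace ℝ (Fin d) =>
      lyapunov f xstar t z.1 z.2 := by
  unfold lyapunov
  fun_prop

theorem continuous_refreshGap (t : ℝ) :
    Continuous fun z : EuclideanSpace ℝ (Fin d) × EuclideanSpace ℝ (Fin d) =>
      refreshGap xstar t z.1 z.2 := by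
  unfold refreshGap
  fun_prop

/-- A variable of the past has no correlation with the compensated first event of an increment. -/
theorem IsPoissonProcess.integral_mul_twoPoint_eq_zero [IsProbabilityMeasure P]
    (h : IsPoissonProcess P ℱ γ T) {s t : ℝ} (hs : 0 ≤ s) (hst : s ≤ t) {ψ : Ω → ℝ}
    (hψ : Measurable[ℱ s] ψ) :
    ∫ ω, ψ ω * twoPoint 0 (∫ u in s..t, γ u).toNNReal (-1)
      (eventCount T t ω - eventCount T s ω) ∂P = 0 := by
  set r := (∫ u in s..t, γ u).toNNReal with hr
  set N : Ω → ℕ := fun ω => eventCount T t ω - eventCount T s ω with hN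
  have hlaw : HasLaw N (poissonMeasure r) P := h.increment_law s t hs hst
  have hind : IndepFun ψ N P := by
    rw [IndepFun_iff_Indep]
    exact indep_of_indep_of_le_left (h.increment_indep s t hs hst) hψ.comap_le
  have hw : Measurable (twoPoint 0 (r : ℝ) (-1)) := measurable_of_countable _
  have hind2 : IndepFun ψ (twoPoint 0 (r : ℝ) (-1) ∘ N) P := hind.comp measurable_id hw
  have hmul := hind2.integral_fun_mul_eq_mul_integral (hψ.mono (ℱ.le s) le_rfl).aestronglyMeasurable
    (hw.comp_aemeasurable hlaw.aemeasurable).aestronglyMeasurable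
  -- The weight is `r` on no event and `-1` on one, with probabilities `exp (-r)` and `r * exp
  -- (-r)`.
  have hzero : ∫ ω, (twoPoint 0 (r : ℝ) (-1) ∘ N) ω ∂P = 0 := by
    rw [hlaw.integral_comp hw.aestronglyMeasurable, integral_twoPoint_poissonMeasure]
    ring
  rw [hzero, mul_zero] at hmul
  exact hmul

/-- From `exp (-m) ≥ 1 - m`, the left side is at most `1 - (1 - m) * (1 + m)`. It is the Poisson
probability of at least two events. -/
theorem one_sub_exp_neg_le (m : ℝ) (hm : 0 ≤ m) : 1 - Real.exp (-m) - m * Real.exp (-m) ≤ m ^ 2 := by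
  have := Real.add_one_le_exp (-m)
  nlinarith

/-- On bounded initial data, the Lyapunov function is integrable and nonincreasing in mean. -/
theorem IsRandomizedHamiltonianFlow.setIntegral_lyapunov_le [IsProbabilityMeasure P]
    (hf : Differentiable ℝ f) (hconv : ConvexOn ℝ univ f) (hmin : ∀ x, f xstar ≤ f x)
    (h : IsRandomizedHamiltonianFlow P ℱ f (fun t => 6 / (t + 1)) T X Y)
    (hY : ∀ᵐ ω ∂P, Y 0 ω = 0) (M : ℝ) {K : ℝ} (hK : 0 ≤ K) :
    IntegrableOn (fun ω => lyapunov f xstar K (X K ω) (Y K ω)) (initialEvent f xstar X M) P ∧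
    ∫ ω in initialEvent f xstar X M, lyapunov f xstar K (X K ω) (Y K ω) ∂P ≤
      ∫ ω in initialEvent f xstar X M, lyapunov f xstar 0 (X 0 ω) (Y 0 ω) ∂P := by
  set A := initialEvent f xstar X M with hA
  have hAm : ∀ s, 0 ≤ s → MeasurableSet[ℱ s] A := fun s hs =>
    h.measurableSet_initialEvent hf.continuous M hs
  have hAm' : MeasurableSet A := ℱ.le 0 _ (hAm 0 le_rfl)
  obtain ⟨C, hC, hinc⟩ := exists_lyapunov_increment_bound hf hconv hmin hK M
  set φ : ℝ → Ω → ℝ := fun s => A.indicator fun ω => lyapunov f xstar s (X s ω) (Y s ω) with hφ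
  set ψ : ℝ → Ω → ℝ := fun s => A.indicator fun ω => refreshGap xstar s (X s ω) (Y s ω) with hψ
  have hφm : ∀ s, 0 ≤ s → Measurable[ℱ s] (φ s) := fun s hs =>
    (h.measurable_comp (continuous_lyapunov hf.continuous s) hs).indicator (hAm s hs)
  have hψm : ∀ s, 0 ≤ s → Measurable[ℱ s] (ψ s) := fun s hs =>
    (h.measurable_comp (continuous_refreshGap s) hs).indicator (hAm s hs)
  have hpath := h.ae_exists_isRefreshedPath (continuous_gradient hf hconv) hY
  have hbd : ∀ s, 0 ≤ s → s ≤ K → ∀ᵐ ω ∂P, |φ s ω| ≤ C ∧ |ψ s ω| ≤ C := fun s hs hsK => by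
    filter_upwards [hpath, h.poisson.time_zero, h.poisson.tendsto_atTop] with ω ⟨y, hy⟩ h0 hT
    by_cases hω : ω ∈ A
    · obtain ⟨n, hn, hn'⟩ := exists_mem_Ico_of_tendsto h0 hT hs
      obtain ⟨b1, b2, -⟩ := hinc _ _ _ y hy hω n s hn hn' hsK
      simpa [hφ, hψ, hω] using ⟨b1, b2⟩
    · simp [hφ, hψ, hω, hC]
  have hφi : ∀ s, 0 ≤ s → s ≤ K → Integrable (φ s) P := fun s hs hsK =>
    Integrable.of_bound ((hφm s hs).mono (ℱ.le s) le_rfl).aestronglyMeasurable C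
      ((hbd s hs hsK).mono fun ω hω => hω.1)
  have hψi : ∀ s, 0 ≤ s → s ≤ K → Integrable (ψ s) P := fun s hs hsK =>
    Integrable.of_bound ((hψm s hs).mono (ℱ.le s) le_rfl).aestronglyMeasurable C
      ((hbd s hs hsK).mono fun ω hω => hω.2)
  refine ⟨(integrable_indicator_iff hAm').1 (hφi K hK le_rfl), ?_⟩
  rw [← integral_indicator hAm', ← integral_indicator hAm']
  -- `79 = 1 + 6 + 72`: no event costs `C h²`; one event costs `C h` with probability at most `6 h`;
  -- two or more cost `2 C` with probability at most `(6 h)²`.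
  refine le_of_forall_le_add_sq (a := fun s => ∫ ω, φ s ω ∂P) (C := 79 * C) hK
    fun s t hs hst htK => ?_
  have hsK := hst.trans htK
  have ht := hs.trans hst
  set r := (∫ u in s..t, 6 / (u + 1)).toNNReal with hr
  obtain ⟨l1, l2⟩ := log_add_one_sub_log_le hs hst
  have hrm : (r : ℝ) = 6 * (Real.log (t + 1) - Real.log (s + 1)) := by
    rw [hr, integral_six_div hs hst, Real.coe_toNNReal _ (by positivity)]
  set N : Ω → ℕ := fun ω => eventCount T t ω - eventCount T s ω with hN
  have hlaw : HasLaw N (poissonMeasure r) P := h.poisson.increment_law s t hs hst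
  have hmean : ∫ ω, ψ s ω * twoPoint 0 (r : ℝ) (-1) (N ω) ∂P = 0 :=
    h.poisson.integral_mul_twoPoint_eq_zero hs hst (hψm s hs)
  -- Writing `h = t - s`, the error is `C h²` at `0`, `C h² + C h` at `1` and `C h² + 2 C` beyond,
  -- where only the uniform bound on the Lyapunov function is available.
  set e : ℕ → ℝ := twoPoint (C * (t - s) ^ 2 + 2 * C) (-(2 * C)) (C * (t - s) - 2 * C) with he
  have hem : Measurable e := measurable_of_countable _
  have heint : ∫ ω, e (N ω) ∂P = C * (t - s) ^ 2 + 2 * C + -(2 * C) * Real.exp (-r)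
      + (C * (t - s) - 2 * C) * (r * Real.exp (-r)) := by
    rw [← integral_twoPoint_poissonMeasure, ← hlaw.integral_comp hem.aestronglyMeasurable]
    rfl
  have hei : Integrable (fun ω => e (N ω)) P :=
    (hlaw.map_eq ▸ integrable_twoPoint _ _ _ : Integrable e (P.map N)).comp_aemeasurable
      hlaw.aemeasurable
  have hprod : Integrable (fun ω => ψ s ω * twoPoint 0 (r : ℝ) (-1) (N ω)) P := by
    refine (hψi s hs hsK).mul_bdd (c := r + 1) ((measurable_of_countable
      (twoPoint 0 (r : ℝ) (-1))).comp_aemeasurable hlaw.aemeasurable).aestronglyMeasurable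
      (Eventually.of_forall fun ω => ?_)
    simp only [twoPoint, zero_add]
    refine (norm_add_le _ _).trans (add_le_add ?_ ?_)
    · exact (norm_indicator_le_norm_self _ _).trans (by simp)
    · exact (norm_indicator_le_norm_self _ _).trans (by simp)
  have hpt : ∀ᵐ ω ∂P, φ t ω - φ s ω ≤ ψ s ω * twoPoint 0 (r : ℝ) (-1) (N ω) + e (N ω) := by
    have hts := sub_nonneg.2 hst
    filter_upwards [hpath, h.poisson.time_zero, h.poisson.strictMono, h.poisson.tendsto_atTop,
      hbd s hs hsK, hbd t ht htK] with ω ⟨y, hy⟩ h0 hmono hT bs bt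
    have he0 : 0 ≤ C * (t - s) := by positivity
    have he1 : 0 ≤ C * (t - s) ^ 2 := by positivity
    obtain ⟨n, hn, hn'⟩ := exists_mem_Ico_of_tendsto h0 hT hs
    obtain ⟨k, hk, hk'⟩ := exists_mem_Ico_of_tendsto h0 hT ht
    have hnk : n ≤ k := Nat.lt_succ_iff.1 (hmono.lt_iff_lt.1 ((hn.trans hst).trans_lt hk'))
    have hNω : N ω = k - n := by
      simp only [hN]
      rw [eventCount_eq hmono hk hk', eventCount_eq hmono hn hn']
    by_cases hω : ω ∈ A
    · obtain ⟨-, -, b⟩ := hinc _ _ _ y hy hω n s hn hn' hsK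
      obtain ⟨b1, b2⟩ := b t hst htK
      have eφ : ∀ u, φ u ω = lyapunov f xstar u (X u ω) (Y u ω) := fun u => by simp [hφ, hω]
      have eψ : ψ s ω = refreshGap xstar s (X s ω) (Y s ω) := by simp [hψ, hω]
      rw [← eφ, ← eφ, ← eψ] at b1 b2
      rw [← hrm] at b1
      obtain hk0 | hk1 | hk2 : k = n ∨ k = n + 1 ∨ 2 ≤ k - n := by omega
      · have := b1 (hk0 ▸ hk')
        have hN0 : N ω = 0 := by omega
        simp only [he, twoPoint, hN0]
        simp
        linarith
      · have := b2 (hk1 ▸ hk) (by rw [hk1] at hk'; exact hk')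
        have hN1 : N ω = 1 := by omega
        simp only [he, twoPoint, hN1]
        simp
        linarith
      · have hN0 : N ω ≠ 0 := by omega
        have hN1 : N ω ≠ 1 := by omega
        simp only [he, twoPoint]
        simp [hN0, hN1]
        linarith [(abs_le.1 bs.1).1, (abs_le.1 bt.1).2]
    · have h1 : φ t ω = 0 := by simp [hφ, hω]
      have h2 : φ s ω = 0 := by simp [hφ, hω]
      have h3 : ψ s ω = 0 := by simp [hψ, hω]
      rw [h1, h2, h3, zero_mul, zero_add, sub_zero]
      by_cases hN0 : N ω = 0
      · simp only [he, twoPoint, hN0]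
        simp
        linarith
      · by_cases hN1 : N ω = 1
        · simp only [he, twoPoint, hN1]
          simp
          linarith
        · simp only [he, twoPoint]
          simp [hN0, hN1]
          linarith
  have hle := integral_mono_ae ((hφi t ht htK).sub (hφi s hs hsK)) (hprod.add hei) hpt
  simp only [Pi.sub_apply, Pi.add_apply] at hle
  rw [integral_sub (hφi t ht htK) (hφi s hs hsK), integral_add hprod hei, hmean, heint] at hle
  have hr0 : (0 : ℝ) ≤ r := r.2
  have hr6 : (r : ℝ) ≤ 6 * (t - s) := by rw [hrm]; linarith
  have q1 := one_sub_exp_neg_le r hr0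
  have q2 : Real.exp (-(r : ℝ)) ≤ 1 := Real.exp_le_one_iff.2 (by linarith)
  have q3 : (r : ℝ) ^ 2 ≤ (6 * (t - s)) ^ 2 := by gcongr
  have q4 : (r : ℝ) * Real.exp (-r) ≤ 6 * (t - s) * 1 := by gcongr
  have hts := sub_nonneg.2 hst
  have q5 : C * (t - s) * (r * Real.exp (-r)) ≤ C * (t - s) * (6 * (t - s) * 1) := by gcongr
  have q6 : C * (1 - Real.exp (-(r : ℝ)) - r * Real.exp (-(r : ℝ))) ≤ C * (6 * (t - s)) ^ 2 :=
    mul_le_mul_of_nonneg_left (q1.trans q3) hC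
  show ∫ ω, φ t ω ∂P ≤ ∫ ω, φ s ω ∂P + 79 * C * (t - s) ^ 2
  linarith

/-- Restriction to bounded initial data makes both sides finite, so the monotonicity of real
integrals transfers to `ℝ≥0∞`. -/
theorem IsRandomizedHamiltonianFlow.setLIntegral_le [IsProbabilityMeasure P]
    (hf : Differentiable ℝ f) (hconv : ConvexOn ℝ univ f) (hmin : ∀ x, f xstar ≤ f x)
    (h : IsRandomizedHamiltonianFlow P ℱ f (fun t => 6 / (t + 1)) T X Y)
    (hY : ∀ᵐ ω ∂P, Y 0 ω = 0) (M : ℝ) {t : ℝ} (ht : 0 ≤ t) :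
    ∫⁻ ω in initialEvent f xstar X M, ENNReal.ofReal (f (X t ω) - f xstar) ∂P
      ≤ ENNReal.ofReal (5 / (t + 1) ^ 2) * ∫⁻ ω in initialEvent f xstar X M,
        ENNReal.ofReal (f (X 0 ω) - f xstar + ‖X 0 ω - xstar‖ ^ 2) ∂P := by
  obtain ⟨hint, hle⟩ := h.setIntegral_lyapunov_le hf hconv hmin hY M ht
  have hAm : MeasurableSet (initialEvent f xstar X M) :=
    ℱ.le 0 _ (h.measurableSet_initialEvent hf.continuous M le_rfl)
  set A := initialEvent f xstar X M with hA
  have ht1 : 0 < (t + 1) ^ 2 := by positivity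
  have hF0 : ∀ ω, 0 ≤ f (X t ω) - f xstar := fun ω => sub_nonneg.2 (hmin _)
  have hR0 : ∀ ω, 0 ≤ f (X 0 ω) - f xstar + ‖X 0 ω - xstar‖ ^ 2 := fun ω =>
    add_nonneg (sub_nonneg.2 (hmin _)) (sq_nonneg _)
  have hFφ : ∀ ω, f (X t ω) - f xstar ≤ lyapunov f xstar t (X t ω) (Y t ω) / (t + 1) ^ 2 :=
    fun ω => by
      rw [le_div_iff₀ ht1, mul_comm]
      exact sq_mul_le_lyapunov _ _
  have hFm : Measurable fun ω => f (X t ω) - f xstar :=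
    (h.measurable_comp (g := fun z _ => f z - f xstar) (by have := hf.continuous; fun_prop)
      ht).mono (ℱ.le t) le_rfl
  have hRm : Measurable fun ω => f (X 0 ω) - f xstar + ‖X 0 ω - xstar‖ ^ 2 :=
    (h.measurable_comp (g := fun z _ => f z - f xstar + ‖z - xstar‖ ^ 2)
      (by have := hf.continuous; fun_prop) le_rfl).mono (ℱ.le 0) le_rfl
  have hFi : IntegrableOn (fun ω => f (X t ω) - f xstar) A P :=
    (hint.div_const _).mono' hFm.aestronglyMeasurable (Eventually.of_forall fun ω => by
      rw [Real.norm_of_nonneg (hF0 ω)]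
      exact hFφ ω)
  have hRi : IntegrableOn (fun ω => f (X 0 ω) - f xstar + ‖X 0 ω - xstar‖ ^ 2) A P := by
    refine Integrable.of_bound hRm.aestronglyMeasurable M
      ((ae_restrict_mem hAm).mono fun ω hω => ?_)
    rw [Real.norm_of_nonneg (hR0 ω)]
    exact hω
  obtain ⟨hint0, -⟩ := h.setIntegral_lyapunov_le hf hconv hmin hY M le_rfl
  rw [← ofReal_integral_eq_lintegral_ofReal hFi (Eventually.of_forall hF0),
    ← ofReal_integral_eq_lintegral_ofReal hRi (Eventually.of_forall hR0),
    ← ENNReal.ofReal_mul (by positivity)]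
  refine ENNReal.ofReal_le_ofReal ?_
  calc ∫ ω in A, (f (X t ω) - f xstar) ∂P
      ≤ ∫ ω in A, lyapunov f xstar t (X t ω) (Y t ω) / (t + 1) ^ 2 ∂P :=
        integral_mono hFi (hint.div_const _) hFφ
    _ = (∫ ω in A, lyapunov f xstar t (X t ω) (Y t ω) ∂P) / (t + 1) ^ 2 := integral_div _ _
    _ ≤ (∫ ω in A, lyapunov f xstar 0 (X 0 ω) (Y 0 ω) ∂P) / (t + 1) ^ 2 := by gcongr
    _ ≤ (∫ ω in A, 5 * (f (X 0 ω) - f xstar + ‖X 0 ω - xstar‖ ^ 2) ∂P) / (t + 1) ^ 2 := by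
        refine div_le_div_of_nonneg_right ?_ ht1.le
        refine integral_mono_ae hint0 (hRi.const_mul 5) ?_
        filter_upwards [ae_restrict_of_ae hY] with ω hω
        simp only [lyapunov, hω, norm_zero, inner_zero_right]
        linarith [hmin (X 0 ω)]
    _ = 5 / (t + 1) ^ 2 * ∫ ω in A, (f (X 0 ω) - f xstar + ‖X 0 ω - xstar‖ ^ 2) ∂P := by
        rw [integral_const_mul]
        ring

end Flow

end RHF

theorem theorem3p2 {d : ℕ} (f : EuclideanSpace ℝ (Fin d) → ℝ)
    (hf : Differentiable ℝ f) (hconv : ConvexOn ℝ Set.univ f)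
    (xstar : EuclideanSpace ℝ (Fin d)) (hmin : ∀ x, f xstar ≤ f x)
    {Ω : Type*} {mΩ : MeasurableSpace Ω} (P : Measure Ω) [IsProbabilityMeasure P]
    (ℱ : Filtration ℝ mΩ) (T : ℕ → Ω → ℝ) (X Y : ℝ → Ω → EuclideanSpace ℝ (Fin d))
    (hXY : RHF.IsRandomizedHamiltonianFlow P ℱ f (fun t => 6 / (t + 1)) T X Y)
    (hY : ∀ᵐ ω ∂P, Y 0 ω = 0) (t : ℝ) (ht : 0 ≤ t) :
    (∫⁻ ω, ENNReal.ofReal (f (X t ω) - f xstar) ∂P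
      ≤ ENNReal.ofReal (5 / (t + 1) ^ 2) *
        ∫⁻ ω, ENNReal.ofReal (f (X 0 ω) - f xstar + ‖X 0 ω - xstar‖ ^ 2) ∂P) ∧
    (Integrable (fun ω => f (X 0 ω) - f xstar + ‖X 0 ω - xstar‖ ^ 2) P →
      Integrable (fun ω => f (X t ω) - f xstar) P ∧
      ∫ ω, (f (X t ω) - f xstar) ∂P
        ≤ 5 * (∫ ω, (f (X 0 ω) - f xstar + ‖X 0 ω - xstar‖ ^ 2) ∂P) / (t + 1) ^ 2) := by
  have hmain : ∫⁻ ω, ENNReal.ofReal (f (X t ω) - f xstar) ∂P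
      ≤ ENNReal.ofReal (5 / (t + 1) ^ 2) *
        ∫⁻ ω, ENNReal.ofReal (f (X 0 ω) - f xstar + ‖X 0 ω - xstar‖ ^ 2) ∂P := by
    have hmono : Monotone fun n : ℕ => RHF.initialEvent f xstar X n := fun m n hmn ω hω =>
      le_trans (b := (m : ℝ)) hω (by exact_mod_cast hmn)
    have hU : ⋃ n : ℕ, RHF.initialEvent f xstar X n = Set.univ := by
      refine Set.eq_univ_of_forall fun ω => Set.mem_iUnion.2 ?_
      exact exists_nat_ge (f (X 0 ω) - f xstar + ‖X 0 ω - xstar‖ ^ 2)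
    -- The events of bounded initial data increase to the whole space, and the localized estimate
    -- has a constant independent of the bound.
    rw [← setLIntegral_univ, ← hU, setLIntegral_iUnion_of_directed _ hmono.directed_le]
    refine iSup_le fun n => (hXY.setLIntegral_le hf hconv hmin hY n ht).trans ?_
    gcongr
    exact Measure.restrict_le_self
  refine ⟨hmain, fun hint => ?_⟩
  have hF0 : ∀ ω, 0 ≤ f (X t ω) - f xstar := fun ω => sub_nonneg.2 (hmin _)
  have hR0 : ∀ ω, 0 ≤ f (X 0 ω) - f xstar + ‖X 0 ω - xstar‖ ^ 2 := fun ω =>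
    add_nonneg (sub_nonneg.2 (hmin _)) (sq_nonneg _)
  have hFm : Measurable fun ω => f (X t ω) - f xstar :=
    (hXY.measurable_comp (g := fun z _ => f z - f xstar) (by have := hf.continuous; fun_prop)
      ht).mono (ℱ.le t) le_rfl
  rw [← ofReal_integral_eq_lintegral_ofReal hint (Filter.Eventually.of_forall hR0),
    ← ENNReal.ofReal_mul (by positivity)] at hmain
  have hFi : Integrable (fun ω => f (X t ω) - f xstar) P :=
    (lintegral_ofReal_ne_top_iff_integrable hFm.aestronglyMeasurable
      (Filter.Eventually.of_forall hF0)).1 (ne_top_of_le_ne_top ENNReal.ofReal_ne_top hmain)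
  refine ⟨hFi, ?_⟩
  rw [← ofReal_integral_eq_lintegral_ofReal hFi (Filter.Eventually.of_forall hF0),
    ENNReal.ofReal_le_ofReal_iff (mul_nonneg (by positivity) (integral_nonneg hR0))] at hmain
  exact hmain.trans (le_of_eq (by ring))
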